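/- Let $k$ be a positive integer and let $H$ and $V$ be finite sets of words ("patterns") in the alphabet $\{0,1\}$. A word $w_1\cdots w_m$ \emph{avoids} a pattern $p_1\cdots p_r$ if there is no $i$ such that $w_i=p_1,\dots,w_{i+r-1}=p_r$. For a positive integer $n$, let $b_{H,V,k}(n)$ be the number of $2k\times 2n$ matrices with entries in $\{0,1\}$ that are balanced (every row contains exactly $n$ ones and every column contains exactly $k$ ones), such that every row avoids every pattern in $H$ and every column avoids every pattern in $V$. Then the sequence $(b_{H,V,k}(n))_{n\ge 1}$ is holonomic: there exist a positive integer $L$ and polynomials $p_0,\dots,p_L$ with rational coefficients, with $p_L$ not the zero polynomial, such that $$\sum_{i=0}^{L} p_i(n)\, b_{H,V,k}(n+i)=0 \qquad\text{for all integers } n\ge 1.$$ -/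

import Mathlib

/-- The word `w` avoids the pattern `p`: `p` does not occur as a block of consecutive
letters of `w`. -/
def Avoids {m : ℕ} (w : Fin m → Fin 2) (p : List (Fin 2)) : Prop :=
  ¬ p <:+: List.ofFn w

/-- A `2k × 2n` matrix with entries in `{0,1}` is balanced if every row has exactly `n` ones
(hence `n` zeroes) and every column has exactly `k` ones (hence `k` zeroes). -/
def IsBalanced {k n : ℕ} (M : Matrix (Fin (2 * k)) (Fin (2 * n)) (Fin 2)) : Prop :=
  (∀ i, (Finset.univ.filter fun j => M i j = 1).card = n) ∧
    (∀ j, (Finset.univ.filter fun i => M i j = 1).card = k)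

/-- The number of balanced `2k × 2n` matrices with entries in `{0,1}` all of whose rows (read
from left to right) avoid the patterns in `H` and all of whose columns (read from top to bottom)
avoid the patterns in `V`. -/
noncomputable def balancedCount (H V : Finset (List (Fin 2))) (k n : ℕ) : ℕ :=
  Nat.card {M : Matrix (Fin (2 * k)) (Fin (2 * n)) (Fin 2) //
    IsBalanced M ∧ (∀ i, ∀ p ∈ H, Avoids (fun j => M i j) p) ∧
      (∀ j, ∀ p ∈ V, Avoids (fun i => M i j) p)}

/-! Give row i a variable x_i and weight each column by the product of the x_i over its ones. Then
`balancedCount` at n is the coefficient of (∏ x_i)^n in the series of all column sequences whose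
rows avoid H: the exponents force the row sums. Every admitted column has degree k, so total degree
2kn forces 2n columns. Row avoidance is a regular condition (`isRegular_forall_not_infix`), checked
on all rows at once by `DFA.rows`, so the transfer matrix makes this series rational
(`DFA.exists_denominator_weightSeries`). The diagonal of a rational series satisfies a polynomial
recurrence (`exists_diagonal_recurrence`). This is Lipshitz's dimension count: products of monomials
and Euler operators applied to F outnumber the coefficients available over a common denominator, so
they are linearly dependent. Suitably chosen operators turn that dependence into a relation on the
diagonal. -/

/-! ### Diagonals of rational power series -/

section Diagonal

open MvPowerSeries

variable {σ : Type*}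

/-- All exponents occurring in `G` are at most `E` in every variable. -/
def SupportBounded (E : ℕ) (G : MvPowerSeries σ ℚ) : Prop :=
  ∀ e : σ →₀ ℕ, (∃ i, E < e i) → coeff e G = 0

theorem SupportBounded.mono {E E' : ℕ} {G : MvPowerSeries σ ℚ} (h : SupportBounded E G)
    (hE : E ≤ E') : SupportBounded E' G :=
  fun e ⟨i, hi⟩ => h e ⟨i, hE.trans_lt hi⟩

theorem SupportBounded.add {E : ℕ} {G K : MvPowerSeries σ ℚ} (hG : SupportBounded E G)
    (hK : SupportBounded E K) : SupportBounded E (G + K) := by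
  intro e he
  rw [map_add, hG e he, hK e he, add_zero]

theorem SupportBounded.smul {E : ℕ} {G : MvPowerSeries σ ℚ} (c : ℚ) (hG : SupportBounded E G) :
    SupportBounded E (c • G) := by
  intro e he
  rw [map_smul, hG e he, smul_zero]

theorem SupportBounded.sum {E : ℕ} {α : Type*} {s : Finset α} {G : α → MvPowerSeries σ ℚ}
    (h : ∀ a ∈ s, SupportBounded E (G a)) : SupportBounded E (∑ a ∈ s, G a) := by
  intro e he
  rw [map_sum]
  exact Finset.sum_eq_zero fun a ha => h a ha e he

theorem SupportBounded.mul {E E' : ℕ} {G K : MvPowerSeries σ ℚ} (hG : SupportBounded E G)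
    (hK : SupportBounded E' K) : SupportBounded (E + E') (G * K) := by
  classical
  rintro e ⟨i, hi⟩
  rw [coeff_mul]
  refine Finset.sum_eq_zero fun p hp => ?_
  rw [Finset.HasAntidiagonal.mem_antidiagonal] at hp
  have h : p.1 i + p.2 i = e i := by rw [← hp]; rfl
  rcases lt_or_ge E (p.1 i) with h1 | h1
  · rw [hG _ ⟨i, h1⟩, zero_mul]
  · rw [hK _ ⟨i, by omega⟩, mul_zero]

theorem supportBounded_monomial {E : ℕ} {e : σ →₀ ℕ} (he : ∀ i, e i ≤ E) (c : ℚ) :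
    SupportBounded E (monomial e c) := by
  classical
  rintro e' ⟨i, hi⟩
  rw [coeff_monomial, if_neg]
  rintro rfl
  exact absurd (he i) (not_le.2 hi)

theorem exists_supportBounded_coe (p : MvPolynomial σ ℚ) :
    ∃ E, SupportBounded E (p : MvPowerSeries σ ℚ) := by
  refine ⟨p.totalDegree, fun e ⟨i, hi⟩ => ?_⟩
  rw [MvPolynomial.coeff_coe]
  by_contra h
  have h1 := MvPolynomial.le_totalDegree (MvPolynomial.mem_support_iff.2 h)
  have h2 : e i ≤ e.sum fun _ n => n := by
    by_cases h0 : e i = 0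
    · omega
    · exact Finset.single_le_sum (f := fun i => e i) (fun _ _ => Nat.zero_le _)
        (Finsupp.mem_support_iff.2 h0)
  omega

/-- Multiplication of the coefficient at `e` by `φ e`. -/
def coeffMul (φ : (σ →₀ ℕ) → ℚ) (G : MvPowerSeries σ ℚ) : MvPowerSeries σ ℚ :=
  fun e => φ e * coeff e G

theorem coeff_coeffMul (φ : (σ →₀ ℕ) → ℚ) (G : MvPowerSeries σ ℚ) (e : σ →₀ ℕ) :
    coeff e (coeffMul φ G) = φ e * coeff e G := rfl

theorem SupportBounded.coeffMul {E : ℕ} {G : MvPowerSeries σ ℚ} (h : SupportBounded E G)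
    (φ : (σ →₀ ℕ) → ℚ) : SupportBounded E (coeffMul φ G) := by
  intro e he
  rw [coeff_coeffMul, h e he, mul_zero]

theorem coeffMul_mul_of_additive {φ : (σ →₀ ℕ) → ℚ} (hφ : ∀ a b, φ (a + b) = φ a + φ b)
    (G K : MvPowerSeries σ ℚ) : coeffMul φ (G * K) = coeffMul φ G * K + G * coeffMul φ K := by
  classical
  ext e
  rw [map_add, coeff_coeffMul, coeff_mul, coeff_mul, coeff_mul, Finset.mul_sum,
    ← Finset.sum_add_distrib]
  refine Finset.sum_congr rfl fun p hp => ?_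
  rw [Finset.HasAntidiagonal.mem_antidiagonal] at hp
  rw [coeff_coeffMul, coeff_coeffMul, ← hp, hφ]
  ring

/-- Power rule for the derivation given by an additive φ; the extra factor Q avoids the exponent m -
1. -/
theorem mul_coeffMul_pow_of_additive {φ : (σ →₀ ℕ) → ℚ} (hφ : ∀ a b, φ (a + b) = φ a + φ b)
    (Q : MvPowerSeries σ ℚ) (m : ℕ) :
    Q * coeffMul φ (Q ^ m) = (m : ℚ) • (coeffMul φ Q * Q ^ m) := by
  induction m with
  | zero =>
    classical
    have h0 : φ 0 = 0 := by simpa using hφ 0 0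
    have : coeffMul φ (1 : MvPowerSeries σ ℚ) = 0 := by
      ext e
      rw [coeff_coeffMul, coeff_one]
      by_cases he : e = 0 <;> simp [he, h0]
    simp [this]
  | succ m ih =>
    rw [pow_succ, coeffMul_mul_of_additive hφ, mul_add, ← mul_assoc, ih, Nat.cast_succ, add_smul,
      one_smul, smul_mul_assoc]
    ring_nf

/-- `φ` acts on coefficients like a differential operator of order at most `r`, as seen on series
with denominator a power of `Q`. -/
def ActsWithOrder (Q : MvPowerSeries σ ℚ) (D r : ℕ) (φ : (σ →₀ ℕ) → ℚ) : Prop :=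
  ∀ (m E : ℕ) (G : MvPowerSeries σ ℚ), SupportBounded E (Q ^ m * G) →
    SupportBounded (E + r * D) (Q ^ (m + r) * coeffMul φ G)

section ActsWithOrder

variable {Q : MvPowerSeries σ ℚ} {D : ℕ}

theorem ActsWithOrder.mono (hQ : SupportBounded D Q) {r r' : ℕ} {φ : (σ →₀ ℕ) → ℚ}
    (h : ActsWithOrder Q D r φ) (hr : r ≤ r') : ActsWithOrder Q D r' φ := by
  intro m E G hG
  obtain ⟨t, rfl⟩ := Nat.exists_eq_add_of_le hr
  clear hr
  induction t with
  | zero => exact h m E G hG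
  | succ t ih =>
    have := hQ.mul ih
    rw [← mul_assoc, ← pow_succ'] at this
    refine this.mono (le_of_eq ?_)
    ring

theorem actsWithOrder_affine (hQ : SupportBounded D Q) {φ : (σ →₀ ℕ) → ℚ}
    (hφ : ∀ a b, φ (a + b) = φ a + φ b) (c : ℚ) :
    ActsWithOrder Q D 1 (fun e => φ e + c) := by
  intro m E G hG
  have h1 : coeffMul (fun e => φ e + c) G = coeffMul φ G + c • G := by
    ext e
    simp only [coeff_coeffMul, map_add, map_smul, smul_eq_mul]
    ring
  -- Quotient rule with denominators cleared: a derivation costs one more factor Q.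
  have h2 : Q ^ (m + 1) * coeffMul (fun e => φ e + c) G =
      Q * coeffMul φ (Q ^ m * G) + (-(m : ℚ)) • (coeffMul φ Q * (Q ^ m * G)) +
        c • (Q * (Q ^ m * G)) := by
    have h3 := mul_coeffMul_pow_of_additive hφ Q m
    rw [h1, coeffMul_mul_of_additive hφ, mul_add Q, ← mul_assoc Q (coeffMul φ (Q ^ m)), h3,
      neg_smul, ← mul_assoc (coeffMul φ Q), smul_mul_assoc, mul_add, mul_smul_comm]
    ring_nf
  rw [h2, one_mul, add_comm E D]
  exact ((hQ.mul (hG.coeffMul φ)).add (((hQ.coeffMul φ).mul hG).smul _)).add ((hQ.mul hG).smul c)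

theorem actsWithOrder_one : ActsWithOrder Q D 0 (fun _ => 1) := by
  intro m E G hG
  have : coeffMul (fun _ => 1) G = G := by
    ext e
    rw [coeff_coeffMul, one_mul]
  simpa [this] using hG

theorem ActsWithOrder.mul {r r' : ℕ} {φ ψ : (σ →₀ ℕ) → ℚ} (hφ : ActsWithOrder Q D r φ)
    (hψ : ActsWithOrder Q D r' ψ) : ActsWithOrder Q D (r + r') (fun e => φ e * ψ e) := by
  intro m E G hG
  have h1 : coeffMul (fun e => φ e * ψ e) G = coeffMul φ (coeffMul ψ G) := by
    ext e
    simp only [coeff_coeffMul]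
    ring
  have h2 := hφ _ _ _ (hψ _ _ _ hG)
  rw [h1, show m + (r + r') = m + r' + r by ring, show E + (r + r') * D = E + r' * D + r * D by ring]
  exact h2

theorem ActsWithOrder.prod {α : Type*} (s : Finset α) {r : α → ℕ} {φ : α → (σ →₀ ℕ) → ℚ}
    (h : ∀ a ∈ s, ActsWithOrder Q D (r a) (φ a)) :
    ActsWithOrder Q D (∑ a ∈ s, r a) (fun e => ∏ a ∈ s, φ a e) := by
  classical
  induction s using Finset.induction_on with
  | empty => simpa using actsWithOrder_one
  | insert a s ha ih =>
    simp only [Finset.prod_insert ha, Finset.sum_insert ha]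
    exact (h a (Finset.mem_insert_self a s)).mul
      (ih fun b hb => h b (Finset.mem_insert_of_mem hb))

end ActsWithOrder

variable [Fintype σ] [DecidableEq σ]

/-- The symbol of the operator `θ ^ a * ∏ (θ i - θ - 1) (θ i - θ - 2) ⋯`, where `θ` is the Euler
operator of the variable `i₀`. -/
def lipshitzSymbol (i₀ : σ) (a : ℕ) (β : {i // i ≠ i₀} → ℕ) (e : σ →₀ ℕ) : ℚ :=
  (∏ _t ∈ Finset.range a, ((e i₀ : ℚ) + 0)) *
    ∏ i : {i // i ≠ i₀}, ∏ t ∈ Finset.range (β i), (((e i.1 : ℚ) - e i₀) + (-1 - t))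

theorem actsWithOrder_lipshitzSymbol {Q : MvPowerSeries σ ℚ} {D : ℕ} (hQ : SupportBounded D Q)
    (i₀ : σ) {N a : ℕ} {β : {i // i ≠ i₀} → ℕ} (ha : a ≤ N) (hβ : ∀ i, β i ≤ N) :
    ActsWithOrder Q D (Fintype.card σ * N) (lipshitzSymbol i₀ a β) := by
  have h1 : ActsWithOrder Q D (∑ _t ∈ Finset.range a, 1)
      (fun e => ∏ _t ∈ Finset.range a, ((e i₀ : ℚ) + 0)) := by
    refine ActsWithOrder.prod (φ := fun _ e => (e i₀ : ℚ) + 0) _ fun t _ => ?_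
    exact actsWithOrder_affine hQ (φ := fun e => (e i₀ : ℚ)) (fun a b => by simp) 0
  have h2 : ActsWithOrder Q D (∑ i : {i // i ≠ i₀}, ∑ _t ∈ Finset.range (β i), 1)
      (fun e => ∏ i : {i // i ≠ i₀}, ∏ t ∈ Finset.range (β i),
        (((e i.1 : ℚ) - e i₀) + (-1 - t))) := by
    refine ActsWithOrder.prod (φ := fun i e => ∏ t ∈ Finset.range (β i),
        (((e i.1 : ℚ) - e i₀) + (-1 - t))) _ fun i _ => ?_
    refine ActsWithOrder.prod (φ := fun (t : ℕ) e => (((e i.1 : ℚ) - e i₀) + (-1 - t))) _ fun t _ => ?_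
    refine actsWithOrder_affine hQ (φ := fun e => (e i.1 : ℚ) - e i₀) (fun a b => ?_) _
    simp only [Finsupp.add_apply, Nat.cast_add]
    ring
  refine (h1.mul h2).mono hQ ?_
  simp only [Finset.sum_const, Finset.card_range, smul_eq_mul, mul_one]
  have h3 : ∑ i, β i ≤ (Fintype.card σ - 1) * N := by
    refine (Finset.sum_le_card_nsmul _ _ N fun i _ => hβ i).trans ?_
    simp
  have h4 : 0 < Fintype.card σ := Fintype.card_pos_iff.2 ⟨i₀⟩
  obtain ⟨d, hd⟩ := Nat.exists_eq_add_of_lt h4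
  rw [hd] at h3 ⊢
  simp only [zero_add, Nat.add_sub_cancel] at h3 ⊢
  rw [add_mul, one_mul]
  omega

/-- The exponent of the monomial `(∏ i, x i) ^ j * ∏ i ≠ i₀, x i ^ (N - β i)`. -/
noncomputable def shiftExponent (i₀ : σ) (N j : ℕ) (β : {i // i ≠ i₀} → ℕ) : σ →₀ ℕ :=
  Finsupp.equivFunOnFinite.symm fun i => j + if h : i ≠ i₀ then N - β ⟨i, h⟩ else 0

theorem shiftExponent_apply_base (i₀ : σ) (N j : ℕ) (β : {i // i ≠ i₀} → ℕ) :
    shiftExponent i₀ N j β i₀ = j := by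
  simp [shiftExponent]

theorem shiftExponent_apply_coe (i₀ : σ) (N j : ℕ) (β : {i // i ≠ i₀} → ℕ) (i : {i // i ≠ i₀}) :
    shiftExponent i₀ N j β i = j + (N - β i) := by
  simp [shiftExponent, i.2]

/-- The constant exponent `(n, …, n)`. -/
noncomputable def constExponent (σ : Type*) [Fintype σ] (n : ℕ) : σ →₀ ℕ :=
  Finsupp.equivFunOnFinite.symm fun _ => n

omit [DecidableEq σ] in
@[simp] theorem constExponent_apply (n : ℕ) (i : σ) : constExponent σ n i = n := rfl

/-- A rational series satisfies a nontrivial linear relation between the images under the operators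
`shift * lipshitzSymbol`. -/
theorem exists_lipshitz_relation (i₀ : σ) {Q F : MvPowerSeries σ ℚ} {D : ℕ} (hQ0 : Q ≠ 0)
    (hQ : SupportBounded D Q) (hF : SupportBounded D (Q * F)) :
    ∃ N : ℕ, ∃ c : Fin N × Fin N × ({i // i ≠ i₀} → Fin N) → ℚ, c ≠ 0 ∧
      ∑ t, c t • (monomial (shiftExponent i₀ N t.1 (fun i => t.2.2 i)) (1 : ℚ) *
        coeffMul (lipshitzSymbol i₀ t.2.1 (fun i => t.2.2 i)) F) = 0 := by
  set d := Fintype.card σ with hd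
  have hdpos : 0 < d := Fintype.card_pos_iff.2 ⟨i₀⟩
  -- C gives E + 1 ≤ C * N, and N exceeds C ^ d. Hence the N ^ (d + 1) unknowns outnumber the (E +
  -- 1) ^ d coefficient equations.
  set C := D + d * D + 3 with hC
  set N := C ^ d + 1 with hN
  set E := 2 * N + (D + d * N * D) with hE
  set T : Fin N × Fin N × ({i // i ≠ i₀} → Fin N) → MvPowerSeries σ ℚ := fun t =>
    monomial (shiftExponent i₀ N t.1 (fun i => t.2.2 i)) (1 : ℚ) *
        coeffMul (lipshitzSymbol i₀ t.2.1 (fun i => t.2.2 i)) F with hT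
  have hb : ∀ t, SupportBounded E (Q ^ (1 + d * N) * T t) := by
    intro t
    have h1 := actsWithOrder_lipshitzSymbol hQ i₀ (N := N) (a := t.2.1) (β := fun i => t.2.2 i)
      t.2.1.2.le (fun i => (t.2.2 i).2.le) 1 D F (by simpa using hF)
    have h2 : ∀ i, shiftExponent i₀ N t.1 (fun i => t.2.2 i) i ≤ 2 * N := by
      intro i
      have := t.1.2
      by_cases hi : i = i₀
      · rw [hi, shiftExponent_apply_base]; omega
      · rw [shiftExponent_apply_coe i₀ N _ _ ⟨i, hi⟩]; omega
    have h3 := (supportBounded_monomial h2 1).mul h1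
    simp only [hT]
    rw [mul_left_comm]
    exact h3
  let Φ : (Fin N × Fin N × ({i // i ≠ i₀} → Fin N) → ℚ) →ₗ[ℚ] ((σ → Fin (E + 1)) → ℚ) :=
    LinearMap.pi fun e => (coeff (Finsupp.equivFunOnFinite.symm fun i => (e i : ℕ))) ∘ₗ
      (LinearMap.mulLeft ℚ (Q ^ (1 + d * N))) ∘ₗ (Fintype.linearCombination ℚ T)
  have hrank : Module.finrank ℚ ((σ → Fin (E + 1)) → ℚ) <
      Module.finrank ℚ (Fin N × Fin N × ({i // i ≠ i₀} → Fin N) → ℚ) := by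
    simp only [Module.finrank_fintype_fun_eq_card, Fintype.card_prod, Fintype.card_fun,
      Fintype.card_fin]
    have h1 : Fintype.card {i // i ≠ i₀} = d - 1 := by simp [hd]
    rw [h1, ← hd]
    have hNpos : 1 ≤ N := by omega
    have h2 : E + 1 ≤ C * N := by
      rw [hE, hC]; nlinarith [Nat.zero_le (d * D), mul_le_mul_of_nonneg_left hNpos (Nat.zero_le D)]
    have h3 : N * (N * N ^ (d - 1)) = N * N ^ d := by
      rw [← pow_succ', Nat.sub_add_cancel hdpos]
    rw [h3]
    calc (E + 1) ^ d ≤ (C * N) ^ d := Nat.pow_le_pow_left h2 d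
      _ = C ^ d * N ^ d := mul_pow _ _ _
      _ < N * N ^ d := Nat.mul_lt_mul_of_pos_right (by omega) (by positivity)
  obtain ⟨c, hc, hc0⟩ := (Submodule.ne_bot_iff _).1 (LinearMap.ker_ne_bot_of_finrank_lt (f := Φ) hrank)
  refine ⟨N, c, hc0, ?_⟩
  have hz : Q ^ (1 + d * N) * ∑ t, c t • T t = 0 := by
    ext e
    by_cases he : ∃ i, E < e i
    · rw [Finset.mul_sum]
      exact SupportBounded.sum (E := E) (fun t _ => by
        rw [mul_smul_comm]; exact (hb t).smul _) e he
    · push Not at he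
      have := congrFun (LinearMap.mem_ker.1 hc) fun i => ⟨e i, Nat.lt_succ_of_le (he i)⟩
      simp only [Φ, LinearMap.pi_apply, LinearMap.comp_apply, LinearMap.mulLeft_apply,
        Fintype.linearCombination_apply, Pi.zero_apply] at this
      have he' : (Finsupp.equivFunOnFinite.symm fun i => e i) = e := by ext; rfl
      rw [he'] at this
      rw [this, map_zero]
  exact (mul_eq_zero.1 hz).resolve_left (pow_ne_zero _ hQ0)

/-- The diagonal of a rational power series satisfies a polynomial recurrence. -/
theorem exists_diagonal_recurrence (i₀ : σ) {Q F : MvPowerSeries σ ℚ} {D : ℕ} (hQ0 : Q ≠ 0)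
    (hQ : SupportBounded D Q) (hF : SupportBounded D (Q * F)) :
    ∃ (N : ℕ) (q : Fin N → Polynomial ℚ), q ≠ 0 ∧ ∀ n, N ≤ n → ∑ j : Fin N,
      (q j).eval ((n - j : ℕ) : ℚ) * coeff (constExponent σ (n - j)) F = 0 := by
  obtain ⟨N, c, hc, hrel⟩ := exists_lipshitz_relation i₀ hQ0 hQ hF
  -- Minimality of the total of β makes every term with another β vanish at the coefficient
  -- extracted below.
  obtain ⟨t₀, ht₀, hmin⟩ := Finset.exists_min_image
    (Finset.univ.filter fun t => c t ≠ 0) (fun t => ∑ i, (t.2.2 i : ℕ)) (by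
      obtain ⟨t, ht⟩ := Function.ne_iff.1 hc
      exact ⟨t, by simpa using ht⟩)
  simp only [Finset.mem_filter, Finset.mem_univ, true_and] at ht₀ hmin
  set γ := t₀.2.2 with hγ
  refine ⟨N, fun j => ∑ a : Fin N, Polynomial.monomial a (c (j, a, γ)), fun h => ?_, fun n hn => ?_⟩
  · have h1 := congrArg (fun p => Polynomial.coeff p (t₀.2.1 : ℕ)) (congrFun h t₀.1)
    simp only [Polynomial.finsetSum_coeff, Polynomial.coeff_monomial, Fin.val_inj,
      Finset.sum_ite_eq', Finset.mem_univ, if_true] at h1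
    exact ht₀ (by simpa [hγ] using h1)
  set K : ℚ := ∏ i, ∏ t ∈ Finset.range (γ i : ℕ), (-1 - t : ℚ) with hK
  have hK0 : K ≠ 0 := by
    refine Finset.prod_ne_zero_iff.2 fun i _ => Finset.prod_ne_zero_iff.2 fun t _ => ?_
    have : (0 : ℚ) ≤ t := Nat.cast_nonneg t
    linarith
  have hco := congrArg (coeff (shiftExponent i₀ N n (fun i => γ i))) hrel
  rw [map_sum, map_zero] at hco
  have hne : ∀ t : Fin N × Fin N × ({i // i ≠ i₀} → Fin N), t.2.2 ≠ γ →
      coeff (shiftExponent i₀ N n (fun i => γ i))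
        (c t • (monomial (shiftExponent i₀ N t.1 (fun i => t.2.2 i)) (1 : ℚ) *
          coeffMul (lipshitzSymbol i₀ t.2.1 (fun i => t.2.2 i)) F)) = 0 := by
    intro t ht
    by_cases hct : c t = 0
    · rw [hct, zero_smul, map_zero]
    obtain ⟨i, hi⟩ : ∃ i, γ i < t.2.2 i := by
      by_contra! hle
      refine ht ?_
      have h1 := hmin t hct
      have h2 : ∀ i ∈ Finset.univ, (t.2.2 i : ℕ) ≤ (γ i : ℕ) := fun i _ => hle i
      have h3 := (Finset.sum_eq_sum_iff_of_le h2).1 (le_antisymm (Finset.sum_le_sum h2) h1)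
      funext i
      exact Fin.ext (h3 i (Finset.mem_univ i))
    rw [map_smul, coeff_monomial_mul]
    split_ifs with hle
    · rw [coeff_coeffMul, lipshitzSymbol, Finset.prod_eq_zero (Finset.mem_univ i)]
      · simp
      -- After the shift, the exponents at i and i₀ differ by β i - γ i, which lies in 1, …, β i and
      -- so is a root of the symbol.
      refine Finset.prod_eq_zero (i := (t.2.2 i - γ i - 1 : ℕ)) (Finset.mem_range.2 ?_) ?_
      · have : (γ i : ℕ) < t.2.2 i := hi
        omega
      · have h1 : (γ i : ℕ) < t.2.2 i := hi
        have h2 := t.1.2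
        have h3 := (t.2.2 i).2
        have h4 : ((shiftExponent i₀ N n fun i => (γ i : ℕ)) -
            shiftExponent i₀ N t.1 (fun i => t.2.2 i)) i = n - t.1 + 1 + (t.2.2 i - γ i - 1) := by
          rw [Finsupp.tsub_apply, shiftExponent_apply_coe, shiftExponent_apply_coe]
          omega
        rw [h4, Finsupp.tsub_apply, shiftExponent_apply_base, shiftExponent_apply_base]
        push_cast
        ring
    · simp
  have heq : ∀ (j a : Fin N), coeff (shiftExponent i₀ N n (fun i => γ i))
        (c (j, a, γ) • (monomial (shiftExponent i₀ N j (fun i => γ i)) (1 : ℚ) *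
          coeffMul (lipshitzSymbol i₀ a (fun i => γ i)) F)) =
      K * (c (j, a, γ) * ((n - j : ℕ) : ℚ) ^ (a : ℕ) * coeff (constExponent σ (n - j)) F) := by
    intro j a
    have hj : (j : ℕ) ≤ n := j.2.le.trans hn
    have hle : shiftExponent i₀ N j (fun i => (γ i : ℕ)) ≤
        shiftExponent i₀ N n (fun i => (γ i : ℕ)) := by
      intro i
      simp only [shiftExponent, Finsupp.equivFunOnFinite_symm_apply_apply]
      omega
    have hsub : shiftExponent i₀ N n (fun i => (γ i : ℕ)) -
        shiftExponent i₀ N j (fun i => (γ i : ℕ)) = constExponent σ (n - j) := by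
      ext i
      rw [Finsupp.tsub_apply]
      simp only [shiftExponent, Finsupp.equivFunOnFinite_symm_apply_apply, constExponent_apply]
      omega
    rw [map_smul, coeff_monomial_mul, if_pos hle, hsub, coeff_coeffMul, lipshitzSymbol]
    simp only [constExponent_apply, sub_self, zero_add, add_zero, Finset.prod_const,
      Finset.card_range, smul_eq_mul, one_mul]
    rw [← hK]
    ring
  rw [Fintype.sum_prod_type] at hco
  simp only [Fintype.sum_prod_type] at hco
  have hsum : ∀ (j a : Fin N), ∑ β, coeff (shiftExponent i₀ N n (fun i => γ i))
        (c (j, a, β) • (monomial (shiftExponent i₀ N j (fun i => β i)) (1 : ℚ) *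
          coeffMul (lipshitzSymbol i₀ a (fun i => β i)) F)) =
      K * (c (j, a, γ) * ((n - j : ℕ) : ℚ) ^ (a : ℕ) * coeff (constExponent σ (n - j)) F) := by
    intro j a
    rw [← heq j a]
    exact Finset.sum_eq_single γ (fun β _ hβ => hne (j, a, β) hβ)
      (fun h => absurd (Finset.mem_univ γ) h)
  simp only [hsum, ← Finset.mul_sum] at hco
  have := (mul_eq_zero.1 hco).resolve_left hK0
  rw [← this]
  refine Finset.sum_congr rfl fun j _ => ?_
  simp only [Polynomial.eval_finsetSum, Polynomial.eval_monomial, Finset.sum_mul]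

-- Substituting n + N for n and i = N - j turns backward shifts into forward ones. The least j with
-- a nonzero polynomial gives the leading term.
omit [Fintype σ] [DecidableEq σ] in
theorem exists_recurrence_of_reversed {b : ℕ → ℚ} {N : ℕ} {q : Fin N → Polynomial ℚ} (hq : q ≠ 0)
    (h : ∀ n, N ≤ n → ∑ j : Fin N, (q j).eval ((n - j : ℕ) : ℚ) * b (n - j) = 0) :
    ∃ L : ℕ, 0 < L ∧ ∃ p : ℕ → Polynomial ℚ, p L ≠ 0 ∧
      ∀ n : ℕ, ∑ i ∈ Finset.range (L + 1), (p i).eval (n : ℚ) * b (n + i) = 0 := by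
  classical
  set R : ℕ → Polynomial ℚ := fun j => if hj : j < N then q ⟨j, hj⟩ else 0 with hR
  have hex : ∃ j, R j ≠ 0 := by
    obtain ⟨j, hj⟩ := Function.ne_iff.1 hq
    exact ⟨j, by simpa [hR] using hj⟩
  have hj₀ := Nat.find_spec hex
  have hlt : ∀ j < Nat.find hex, R j = 0 := fun j hj => not_not.1 (Nat.find_min hex hj)
  set j₀ := Nat.find hex
  have hj₀N : j₀ < N := by
    by_contra hlt'
    exact hj₀ (by simp [hR, hlt'])
  -- The polynomials were evaluated at the index of b, here n + i, hence the translation.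
  refine ⟨N - j₀, by omega, fun i => (R (N - i)).comp (Polynomial.X + Polynomial.C (i : ℚ)), ?_,
    fun n => ?_⟩
  · have h1 : N - (N - j₀) = j₀ := by omega
    intro h0
    simp only [h1] at h0
    refine hj₀ ?_
    have := congrArg (fun p => p.comp (Polynomial.X - Polynomial.C ((N - j₀ : ℕ) : ℚ))) h0
    simpa [Polynomial.comp_assoc] using this
  have h1 := h (n + N) (by omega)
  have h2 : ∑ j ∈ Finset.range (N + 1), (R j).eval ((n + N - j : ℕ) : ℚ) * b (n + N - j) = 0 := by
    have hN : R N = 0 := by simp [hR]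
    rw [Finset.sum_range_succ, hN, Polynomial.eval_zero, zero_mul, add_zero, Finset.sum_range, ← h1]
    refine Finset.sum_congr rfl fun j _ => ?_
    simp [hR]
  rw [← Finset.sum_range_reflect] at h2
  rw [← h2]
  refine (Finset.sum_subset_zero_on_sdiff (Finset.range_mono (by omega)) ?_ ?_)
  · intro i hi
    simp only [Finset.mem_sdiff, Finset.mem_range] at hi
    rw [hlt _ (by omega), Polynomial.eval_zero, zero_mul]
  · intro i hi
    simp only [Finset.mem_range] at hi
    have h3 : n + N - (N - i) = n + i := by omega
    simp [h3]

end Diagonal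

/-! ### Regularity of pattern avoidance -/

section Regular

variable {α : Type*}

/-- An occurrence of p in x ++ y lies in x, lies in y, or straddles the cut, where a prefix of p is
a suffix of x. -/
theorem infix_append_congr {p x x' : List α} (h : p <:+: x ↔ p <:+: x')
    (hs : ∀ i, p.take i <:+ x ↔ p.take i <:+ x') (y : List α) :
    p <:+: x ++ y ↔ p <:+: x' ++ y := by
  have hs' : ∀ l₁ l₂, p = l₁ ++ l₂ → (l₁ <:+ x ↔ l₁ <:+ x') := by
    rintro l₁ l₂ rfl
    simpa using hs l₁.length
  rw [List.infix_append_iff, List.infix_append_iff, h]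
  refine or_congr_right (or_congr_right ?_)
  constructor <;> rintro ⟨l₁, l₂, h1, h2, h3⟩
  · exact ⟨l₁, l₂, h1, (hs' _ _ h1).1 h2, h3⟩
  · exact ⟨l₁, l₂, h1, (hs' _ _ h1).2 h2, h3⟩

/-- Myhill–Nerode: a left quotient depends only on the finite signature `sig`. -/
theorem isRegular_not_infix (p : List α) :
    Language.IsRegular ({w | ¬ p <:+: w} : Language α) := by
  refine Language.IsRegular.of_finite_range_leftQuotient ?_
  let sig : List α → Prop × (Fin (p.length + 1) → Prop) :=
    fun x => (p <:+: x, fun i => p.take i <:+ x)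
  have hfac : Function.FactorsThrough
      (Language.leftQuotient ({w | ¬ p <:+: w} : Language α)) sig := by
    intro x x' h
    have h1 : p <:+: x ↔ p <:+: x' := iff_of_eq (congrArg Prod.fst h)
    have h2 : ∀ i, p.take i <:+ x ↔ p.take i <:+ x' := by
      intro i
      rcases le_or_gt i p.length with hi | hi
      · exact iff_of_eq (congrFun (congrArg Prod.snd h) ⟨i, Nat.lt_succ_of_le hi⟩)
      · rw [List.take_of_length_le hi.le]
        simpa [sig] using
          iff_of_eq (congrFun (congrArg Prod.snd h) ⟨p.length, Nat.lt_succ_self _⟩)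
    ext y
    exact not_congr (infix_append_congr h1 h2 y)
  obtain ⟨g, hg⟩ := (Function.factorsThrough_iff _).1 hfac
  rw [hg]
  exact (Set.finite_range g).subset (Set.range_comp_subset_range _ _)

theorem isRegular_forall_not_infix (H : Finset (List α)) :
    Language.IsRegular ({w | ∀ p ∈ H, ¬ p <:+: w} : Language α) := by
  classical
  induction H using Finset.induction_on with
  | empty =>
    refine Language.IsRegular.of_finite_range_leftQuotient ((Set.finite_singleton
      ({w | True} : Language α)).subset ?_)
    rintro _ ⟨x, rfl⟩
    refine Set.mem_singleton_iff.2 ?_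
    ext y
    exact iff_true_intro fun p hp => absurd hp (Finset.notMem_empty p)
  | insert p H _ ih =>
    have h : ({w | ∀ q ∈ insert p H, ¬ q <:+: w} : Language α) =
        ({w | ¬ p <:+: w} : Language α) ⊓ ({w | ∀ q ∈ H, ¬ q <:+: w} : Language α) := by
      ext w
      exact Finset.forall_mem_insert p H (fun q => ¬ q <:+: w)
    rw [h]
    exact (isRegular_not_infix p).inf ih

end Regular

/-! ### Rationality by the transfer matrix -/

section TransferMatrix

variable {σ α S : Type*} [Fintype α]

open Classical in
/-- The weight enumerator of the words of length `m` accepted by `M` from the state `q`. -/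
noncomputable def DFA.weightPoly (M : DFA α S) (wt : α → σ →₀ ℕ) (m : ℕ) (q : S) :
    MvPolynomial σ ℚ :=
  ∑ w : Fin m → α, if List.ofFn w ∈ M.acceptsFrom q then
    MvPolynomial.monomial (∑ j, wt (w j)) 1 else 0

theorem DFA.weightPoly_succ (M : DFA α S) (wt : α → σ →₀ ℕ) (m : ℕ) (q : S) :
    M.weightPoly wt (m + 1) q =
      ∑ a, MvPolynomial.monomial (wt a) 1 * M.weightPoly wt m (M.step q a) := by
  classical
  simp only [DFA.weightPoly, Finset.mul_sum]
  rw [← Fintype.sum_prod_type', ← (Fin.consEquiv fun _ : Fin (m + 1) => α).sum_comp]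
  refine Finset.sum_congr rfl fun x _ => ?_
  have h : List.ofFn (Fin.consEquiv (fun _ : Fin (m + 1) => α) x) = x.1 :: List.ofFn x.2 :=
    List.ofFn_cons _ _
  rw [h]
  simp only [Fin.consEquiv_apply, Fin.sum_univ_succ, Fin.cons_zero, Fin.cons_succ,
    DFA.mem_acceptsFrom, DFA.evalFrom_cons, mul_ite, mul_zero, MvPolynomial.monomial_mul, mul_one]

theorem DFA.coeff_weightPoly_eq_zero (M : DFA α S) {wt : α → σ →₀ ℕ} {k : ℕ}
    (hwt : ∀ a, (wt a).degree = k) {m : ℕ} (q : S) {r : σ →₀ ℕ} (hr : r.degree ≠ m * k) :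
    (M.weightPoly wt m q).coeff r = 0 := by
  classical
  rw [DFA.weightPoly, MvPolynomial.coeff_sum]
  refine Finset.sum_eq_zero fun w _ => ?_
  split_ifs
  · rw [MvPolynomial.coeff_monomial, if_neg]
    rintro rfl
    exact hr (by simp [hwt])
  · simp

/-- The weight enumerator of all words accepted by `M` from the state `q`, when all letters have
weight of degree `k`. -/
noncomputable def DFA.weightSeries (M : DFA α S) (wt : α → σ →₀ ℕ) (k : ℕ) (q : S) :
    MvPowerSeries σ ℚ :=
  fun r => (M.weightPoly wt (r.degree / k) q).coeff r

theorem DFA.coeff_weightSeries (M : DFA α S) (wt : α → σ →₀ ℕ) (k : ℕ) (q : S) (r : σ →₀ ℕ) :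
    MvPowerSeries.coeff r (M.weightSeries wt k q) =
      (M.weightPoly wt (r.degree / k) q).coeff r := rfl

/-- Splitting off the first letter lowers the degree by k, hence the length `degree / k` by one. -/
theorem DFA.weightSeries_eq (M : DFA α S) {wt : α → σ →₀ ℕ} {k : ℕ} (hk : 0 < k)
    (hwt : ∀ a, (wt a).degree = k) (q : S) :
    M.weightSeries wt k q = (M.weightPoly wt 0 q : MvPowerSeries σ ℚ) +
      ∑ a, MvPowerSeries.monomial (wt a) 1 * M.weightSeries wt k (M.step q a) := by
  classical
  ext r
  rw [map_add, map_sum, MvPolynomial.coeff_coe, DFA.coeff_weightSeries]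
  simp only [MvPowerSeries.coeff_monomial_mul, DFA.coeff_weightSeries, one_mul]
  have hsub : ∀ a, wt a ≤ r → (r - wt a).degree + k = r.degree := by
    intro a ha
    rw [← hwt a, ← map_add, tsub_add_cancel_of_le ha]
  rcases lt_or_ge r.degree k with hr | hr
  · rw [Nat.div_eq_of_lt hr, Finset.sum_eq_zero, add_zero]
    intro a _
    rw [if_neg]
    intro ha
    have := hsub a ha
    omega
  · have h0 : r.degree ≠ 0 * k := by omega
    obtain ⟨m, hm⟩ : ∃ m, r.degree / k = m + 1 :=
      Nat.exists_eq_succ_of_ne_zero (Nat.div_pos hr hk).ne'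
    rw [M.coeff_weightPoly_eq_zero hwt q h0, zero_add, hm, DFA.weightPoly_succ,
      MvPolynomial.coeff_sum]
    refine Finset.sum_congr rfl fun a _ => ?_
    rw [MvPolynomial.coeff_monomial_mul']
    split_ifs with ha
    · have h1 : (r - wt a).degree / k = m := by
        have h2 := hsub a ha
        rw [← h2, Nat.add_div_right _ hk] at hm
        omega
      rw [h1, one_mul]
    · rfl

/-- The weight enumerator of a regular language is rational. -/
theorem DFA.exists_denominator_weightSeries [Fintype S] (M : DFA α S) {wt : α → σ →₀ ℕ} {k : ℕ}
    (hk : 0 < k) (hwt : ∀ a, (wt a).degree = k) (q₀ : S) :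
    ∃ (D : ℕ) (Q : MvPowerSeries σ ℚ), Q ≠ 0 ∧ SupportBounded D Q ∧
      SupportBounded D (Q * M.weightSeries wt k q₀) := by
  classical
  let A : Matrix S S (MvPolynomial σ ℚ) := Matrix.of fun q q' =>
    ∑ a, if M.step q a = q' then MvPolynomial.monomial (wt a) 1 else 0
  let f : MvPolynomial σ ℚ →+* MvPowerSeries σ ℚ := MvPolynomial.coeToMvPowerSeries.ringHom
  let F : S → MvPowerSeries σ ℚ := M.weightSeries wt k
  have hAF : ∀ q, ((f.mapMatrix A).mulVec F) q =
      ∑ a, MvPowerSeries.monomial (wt a) 1 * F (M.step q a) := by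
    intro q
    simp only [Matrix.mulVec, dotProduct, RingHom.mapMatrix_apply, Matrix.map_apply, A,
      Matrix.of_apply, map_sum, Finset.sum_mul]
    rw [Finset.sum_comm]
    refine Finset.sum_congr rfl fun a _ => ?_
    rw [Finset.sum_eq_single (M.step q a)]
    · simp [f]
    · intro b _ hb
      rw [if_neg hb.symm, map_zero, zero_mul]
    · exact fun h => absurd (Finset.mem_univ _) h
  have hBF : (f.mapMatrix (1 - A)).mulVec F = fun q => f (M.weightPoly wt 0 q) := by
    funext q
    rw [map_sub, map_one, Matrix.sub_mulVec, Matrix.one_mulVec, Pi.sub_apply, hAF,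
      sub_eq_iff_eq_add]
    exact M.weightSeries_eq hk hwt q
  -- Cramer's rule for (1 - A) F = initial terms.
  have hdet : f (1 - A).det * F q₀ =
      f (((1 - A).adjugate.mulVec fun q => M.weightPoly wt 0 q) q₀) := by
    have h1 := congrArg (f.mapMatrix (1 - A)).adjugate.mulVec hBF
    rw [Matrix.mulVec_mulVec, Matrix.adjugate_mul, Matrix.smul_mulVec, Matrix.one_mulVec,
      ← RingHom.map_adjugate, ← RingHom.map_det] at h1
    have h2 := congrFun h1 q₀
    rw [Pi.smul_apply, smul_eq_mul] at h2
    rw [h2]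
    simp only [Matrix.mulVec, dotProduct, map_sum, map_mul, RingHom.mapMatrix_apply,
      Matrix.map_apply]
  -- Letters have positive degree, so A has zero constant term and the determinant has constant term
  -- 1.
  have hne : (1 - A).det ≠ 0 := by
    intro h0
    have h1 := congrArg (MvPolynomial.constantCoeff (R := ℚ) (σ := σ)) h0
    have h2 : (MvPolynomial.constantCoeff (R := ℚ) (σ := σ)).mapMatrix A = 0 := by
      ext q q'
      simp only [RingHom.mapMatrix_apply, Matrix.map_apply, A, Matrix.of_apply, map_sum,
        Matrix.zero_apply]
      refine Finset.sum_eq_zero fun a _ => ?_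
      split_ifs
      · rw [MvPolynomial.constantCoeff_eq, MvPolynomial.coeff_monomial, if_neg]
        intro ha
        have := hwt a
        rw [ha, map_zero] at this
        omega
      · simp
    rw [RingHom.map_det, map_sub, map_one, h2, sub_zero, Matrix.det_one, map_zero] at h1
    exact one_ne_zero h1
  obtain ⟨D₁, hD₁⟩ := exists_supportBounded_coe (1 - A).det
  obtain ⟨D₂, hD₂⟩ :=
    exists_supportBounded_coe (((1 - A).adjugate.mulVec fun q => M.weightPoly wt 0 q) q₀)
  refine ⟨max D₁ D₂, f (1 - A).det, ?_, hD₁.mono (le_max_left _ _), ?_⟩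
  · exact fun h => hne (MvPolynomial.coe_injective σ ℚ (by simpa [f] using h))
  · change SupportBounded _ (f (1 - A).det * F q₀)
    rw [hdet]
    exact hD₂.mono (le_max_right _ _)

end TransferMatrix

/-! ### Balanced matrices as words of columns -/

section Power

variable {ι β α S : Type*}

/-- The automaton that runs `M` on every row of a matrix read column by column. -/
def DFA.rows (M : DFA β S) (f : α → ι → β) : DFA α (ι → S) where
  step q a i := M.step (q i) (f a i)
  start _ := M.start
  accept := {q | ∀ i, q i ∈ M.accept}

theorem DFA.mem_acceptsFrom_rows (M : DFA β S) (f : α → ι → β) (q : ι → S) (l : List α) :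
    l ∈ (M.rows f).acceptsFrom q ↔ ∀ i, l.map (fun a => f a i) ∈ M.acceptsFrom (q i) := by
  induction l generalizing q with
  | nil => exact Iff.rfl
  | cons a l ih => exact ih _

end Power

/-- The columns admitted in a balanced matrix. -/
abbrev BalancedColumn (V : Finset (List (Fin 2))) (k : ℕ) : Type :=
  {c : Fin (2 * k) → Fin 2 // (Finset.univ.filter fun i => c i = 1).card = k ∧
    ∀ p ∈ V, Avoids c p}

theorem fin_two_val (x : Fin 2) : (x : ℕ) = if x = 1 then 1 else 0 := by
  revert x; decide

/-- The exponent vector of a column. -/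
noncomputable def columnWeight {d : ℕ} (c : Fin d → Fin 2) : Fin d →₀ ℕ :=
  Finsupp.equivFunOnFinite.symm fun i => (c i : ℕ)

theorem degree_columnWeight {d : ℕ} (c : Fin d → Fin 2) :
    (columnWeight c).degree = (Finset.univ.filter fun i => c i = 1).card := by
  rw [Finsupp.degree_eq_sum, Finset.card_filter]
  exact Finset.sum_congr rfl fun i _ => fin_two_val (c i)

open Classical in
theorem coeff_weightSeries_rows {k : ℕ} (hk : 0 < k) (H V : Finset (List (Fin 2))) {S : Type*}
    (M : DFA (Fin 2) S) (hM : M.accepts = {w | ∀ p ∈ H, ¬ p <:+: w}) (n : ℕ) :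
    MvPowerSeries.coeff (constExponent (Fin (2 * k)) n)
      ((M.rows fun (c : BalancedColumn V k) => c.1).weightSeries (fun c => columnWeight c.1) k
        fun _ => M.start) = balancedCount H V k n := by
  have hdeg : (constExponent (Fin (2 * k)) n).degree / k = 2 * n := by
    rw [Finsupp.degree_eq_sum]
    simp only [constExponent_apply, Finset.sum_const, Finset.card_univ, Fintype.card_fin,
      smul_eq_mul]
    rw [show 2 * k * n = 2 * n * k by ring, Nat.mul_div_cancel _ hk]
  have hsum : ∀ w : Fin (2 * n) → BalancedColumn V k,
      ∑ j, columnWeight (w j).1 = constExponent (Fin (2 * k)) n ↔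
        ∀ i, (Finset.univ.filter fun j => (w j).1 i = 1).card = n := by
    intro w
    rw [Finsupp.ext_iff]
    refine forall_congr' fun i => ?_
    rw [Finsupp.finsetSum_apply, constExponent_apply, Finset.card_filter]
    simp only [columnWeight, Finsupp.equivFunOnFinite_symm_apply_apply, fin_two_val]
  have hacc : ∀ w : Fin (2 * n) → BalancedColumn V k,
      List.ofFn w ∈ (M.rows fun (c : BalancedColumn V k) => c.1).acceptsFrom (fun _ => M.start) ↔
        ∀ i, ∀ p ∈ H, Avoids (fun j => (w j).1 i) p := by
    intro w
    rw [DFA.mem_acceptsFrom_rows]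
    refine forall_congr' fun i => ?_
    rw [List.map_ofFn, ← DFA.accepts, hM]
    rfl
  rw [DFA.coeff_weightSeries, hdeg, DFA.weightPoly, MvPolynomial.coeff_sum]
  have hterm : ∀ w : Fin (2 * n) → BalancedColumn V k,
      MvPolynomial.coeff (constExponent (Fin (2 * k)) n)
        (if List.ofFn w ∈ (M.rows fun (c : BalancedColumn V k) => c.1).acceptsFrom
          (fun _ => M.start) then
          MvPolynomial.monomial (∑ j, columnWeight (w j).1) (1 : ℚ) else 0) =
      if (∀ i, ∀ p ∈ H, Avoids (fun j => (w j).1 i) p) ∧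
        ∀ i, (Finset.univ.filter fun j => (w j).1 i = 1).card = n then 1 else 0 := by
    intro w
    simp only [← hacc, ← hsum, ite_and]
    split_ifs with h1 h2
    · rw [MvPolynomial.coeff_monomial, if_pos h2]
    · rw [MvPolynomial.coeff_monomial, if_neg h2]
    · simp
  rw [Finset.sum_congr rfl fun w _ => hterm w, Finset.sum_boole, ← Fintype.card_subtype,
    ← Nat.card_eq_fintype_card, balancedCount]
  congr 1
  -- Transposition between a word of admitted columns and a matrix; only the conditions are
  -- regrouped.
  refine Nat.card_congr
    { toFun := fun w => ⟨fun i j => (w.1 j).1 i, ⟨w.2.2, fun j => (w.1 j).2.1⟩, w.2.1,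
        fun j => (w.1 j).2.2⟩
      invFun := fun A => ⟨fun j => ⟨fun i => A.1 i j, A.2.1.2 j, A.2.2.2 j⟩, A.2.2.1, A.2.1.1⟩
      left_inv := fun _ => rfl
      right_inv := fun _ => rfl }

theorem theorem3 (k : ℕ) (hk : 0 < k) (H V : Finset (List (Fin 2))) :
    ∃ L : ℕ, 0 < L ∧ ∃ p : ℕ → Polynomial ℚ, p L ≠ 0 ∧
      ∀ n : ℕ, 1 ≤ n →
        ∑ i ∈ Finset.range (L + 1),
          (p i).eval (n : ℚ) * (balancedCount H V k (n + i) : ℚ) = 0 := by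
  classical
  obtain ⟨S, _, M, hM⟩ := isRegular_forall_not_infix H
  obtain ⟨D, Q, hQ0, hQ, hF⟩ :=
    (M.rows fun (c : BalancedColumn V k) => c.1).exists_denominator_weightSeries hk
      (wt := fun c => columnWeight c.1) (fun c => (degree_columnWeight c.1).trans c.2.1)
      (fun _ => M.start)
  obtain ⟨N, q, hq, hrec⟩ :=
    exists_diagonal_recurrence (⟨0, by omega⟩ : Fin (2 * k)) hQ0 hQ hF
  simp only [coeff_weightSeries_rows hk H V M hM] at hrec
  obtain ⟨L, hL, p, hp, h⟩ :=
    exists_recurrence_of_reversed (b := fun n => (balancedCount H V k n : ℚ)) hq hrec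
  exact ⟨L, hL, p, hp, fun n _ => h n⟩
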